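/- Two users, $u_{\mathrm r}$ and $u_{\mathrm t}$, are served by a base station through an $N$-element surface ($N\ge 1$) at distance $d>0$ from the base station; user $u_{\mathrm k}$, $\mathrm k\in\{\mathrm r,\mathrm t\}$, is at distance $d_{\mathrm k}>0$ from the surface. Let $\rho>0$ be the transmit SNR, $\alpha$ the (real) path-loss exponent, $p_{\mathrm k}>0$ the power allocation factors, $\beta_{\mathrm k}>0$ the amplitude coefficients, $\delta_{\mathrm k}\in(0,1]$ the resource shares under orthogonal multiple access, and $R^{\mathcal O}_{\mathrm k}$ the target rates. Put $$\kappa=\frac{N\pi^2}{16-\pi^2},\qquad \tau=\frac{16-\pi^2}{4\pi},$$ and assume (Gamma approximation) that the channel gain $W_{\mathrm k}$ of user $u_{\mathrm k}$ is a random variable with density $\dfrac{w^{\kappa-1}e^{-w/\tau}}{\Gamma(\kappa)\tau^{\kappa}}$ on $(0,\infty)$. Then for each user $u_{\mathrm k}$ the ergodic rate is finite and $$\delta_{\mathrm k}\,\mathbb E\!\left[\log_2\!\left(1+\frac{\rho p_{\mathrm k}\beta_{\mathrm k}^2W_{\mathrm k}}{\delta_{\mathrm k}d^{\alpha}d_{\mathrm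 k}^{\alpha}}\right)\right]=\frac{\delta_{\mathrm k}}{\Gamma(\kappa)\ln 2}\,G^{1,3}_{3,2}\!\left(\frac{\tau\rho p_{\mathrm k}\beta_{\mathrm k}^2}{\delta_{\mathrm k}d^{\alpha}d_{\mathrm k}^{\alpha}}\,\middle|\,\begin{matrix}1-\kappa,\,1,\,1\\ 1,\,0\end{matrix}\right).$$ Consequently the coverage region, that is, the set of pairs $(d_{\mathrm t},d_{\mathrm r})$ of positive distances for which the ergodic rate of each user $u_{\mathrm k}$ is at least $R^{\mathcal O}_{\mathrm k}$, is the set of pairs of positive distances such that, for both $\mathrm k\in\{\mathrm r,\mathrm t\}$, $$R^{\mathcal O}_{\mathrm k}\le\frac{\delta_{\mathrm k}}{\Gamma(\kappa)\ln 2}\,G^{1,3}_{3,2}\!\left(\frac{\tau\rho p_{\mathrm k}\beta_{\mathrm k}^2}{\delta_{\mathrm k}d^{\alpha}d_{\mathrm k}^{\alpha}}\,\middle|\,\begin{matrix}1-\kappa,\,1,\,1\\ 1,\,0\end{matrix}\right);$$ the same holds with strict inequalities in both places. Here $G^{m,n}_{p,q}$ is the Meijer G-function; explicitly, for $x>0$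 and any $0<c<1$, $$G^{1,3}_{3,2}\!\left(x\,\middle|\,\begin{matrix}1-\kappa,\,1,\,1\\ 1,\,0\end{matrix}\right)=\frac1{2\pi i}\int_{c-i\infty}^{c+i\infty}\frac{\Gamma(1-s)\,\Gamma(\kappa+s)\,\Gamma(s)^2}{\Gamma(1+s)}\,x^{s}\,ds,$$ and this integral converges absolutely. -/

import Mathlib

open MeasureTheory ProbabilityTheory

noncomputable section

/-- The Mellin--Barnes integrand of the Meijer function `G^{m,n}_{p,q}(z | a; b)`,
`∏_{j ≤ m} Γ(b_j - s) ∏_{j ≤ n} Γ(1 - a_j + s) /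
  (∏_{j > m} Γ(1 - b_j + s) ∏_{j > n} Γ(a_j - s)) * z ^ s`.
(`Complex.Gamma` is `0` at its poles, so the reciprocal factors are the entire function `1 / Γ`.) -/
def meijerGIntegrand (m n : ℕ) {p q : ℕ} (a : Fin p → ℂ) (b : Fin q → ℂ) (z s : ℂ) : ℂ :=
  (∏ j : Fin q,
      if (j : ℕ) < m then Complex.Gamma (b j - s) else (Complex.Gamma (1 - b j + s))⁻¹) *
    (∏ j : Fin p,
      if (j : ℕ) < n then Complex.Gamma (1 - a j + s) else (Complex.Gamma (a j - s))⁻¹) *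
    z ^ s

/-- The upward vertical line `Re s = c` has all poles of `Γ(b_j - s)`, `j ≤ m`, (the points
`b_j + l`, `l = 0, 1, …`) on its right and all poles of `Γ(1 - a_j + s)`, `j ≤ n`, (the points
`a_j - 1 - l`) on its left. -/
def MeijerGSeparates (m n : ℕ) {p q : ℕ} (a : Fin p → ℂ) (b : Fin q → ℂ) (c : ℝ) : Prop :=
  (∀ j : Fin q, (j : ℕ) < m → ∀ l : ℕ, c < (b j + l).re) ∧
    (∀ j : Fin p, (j : ℕ) < n → ∀ l : ℕ, (a j - 1 - l).re < c)

/-- `w` is the value of `G^{m,n}_{p,q}(z | a; b)`, given by the Mellin--Barnes integral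
`(1 / (2πi)) ∫_L … ds` over a vertical line `L` from `c - i∞` to `c + i∞` that separates the two
families of poles: there is such a line, and along each of them the integral converges absolutely
and equals `w`. -/
def HasMeijerG (m n : ℕ) {p q : ℕ} (a : Fin p → ℂ) (b : Fin q → ℂ) (z w : ℂ) : Prop :=
  (∃ c : ℝ, MeijerGSeparates m n a b c) ∧
    ∀ c : ℝ, MeijerGSeparates m n a b c →
      Complex.VerticalIntegrable (meijerGIntegrand m n a b z) c ∧
      (1 / (2 * Real.pi * Complex.I)) *
        (∫ t : ℝ, meijerGIntegrand m n a b z (c + t * Complex.I) * Complex.I) = w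

open Classical in
/-- The Meijer function `G^{m,n}_{p,q}(z | a; b)` (with value `0` if the defining integral over
separating vertical lines makes no sense). -/
def meijerG (m n : ℕ) {p q : ℕ} (a : Fin p → ℂ) (b : Fin q → ℂ) (z : ℂ) : ℂ :=
  if h : ∃ w : ℂ, HasMeijerG m n a b z w then h.choose else 0

/-- The two users: the reflecting user `u_r` and the transmitting user `u_t`. -/
inductive User
  | r
  | t

/-- The shape `κ = N π² / (16 - π²)` of the Gamma law of the channel gain with `N` elements. -/
def gammaShape (N : ℕ) : ℝ := N * Real.pi ^ 2 / (16 - Real.pi ^ 2)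

/-- The scale `τ = (16 - π²) / (4 π)` of the Gamma law of the channel gain. -/
def gammaScale : ℝ := (16 - Real.pi ^ 2) / (4 * Real.pi)

/-- The Gamma approximation: `W` has the density `w ^ (κ - 1) e ^ (-w / τ) / (Γ(κ) τ ^ κ)` on
`(0, ∞)`. (Mathlib's Gamma law is parametrised by shape and rate, the rate being `1 / τ`.) -/
def IsGammaChannel {Ω : Type*} [MeasurableSpace Ω] (μ : Measure Ω) (N : ℕ) (W : Ω → ℝ) : Prop :=
  HasLaw W (gammaMeasure (gammaShape N) (1 / gammaScale)) μ

/-- The SNR `ρ p β² w / (δ d^α D^α)` of an OMA user with power factor `p`, amplitude coefficient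
`β`, resource share `δ` and distance `D` from the surface, when the channel gain is `w`. -/
def omaSNR (ρ α d p β δ D w : ℝ) : ℝ := ρ * p * β ^ 2 * w / (δ * d ^ α * D ^ α)

/-- The ergodic OMA rate `δ E[log₂ (1 + SNR)]`. -/
def omaErgodicRate {Ω : Type*} [MeasurableSpace Ω] (μ : Measure Ω) (W : Ω → ℝ)
    (ρ α d p β δ D : ℝ) : ℝ :=
  δ * ∫ ω, Real.logb 2 (1 + omaSNR ρ α d p β δ D (W ω)) ∂μ

/-- The OMA coverage region: the pairs of distances of the two users from the surface at which
each user `k` is guaranteed the rate `R k`, in the form `R k ≤ (ergodic rate)`. -/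
def omaCoverageRegion {Ω : Type*} [MeasurableSpace Ω] (μ : Measure Ω) (W : User → Ω → ℝ)
    (ρ α d : ℝ) (p β δ R : User → ℝ) : Set (User → ℝ) :=
  {D | ∀ k, 0 < D k ∧ R k ≤ omaErgodicRate μ (W k) ρ α d (p k) (β k) (δ k) (D k)}

/-- The OMA coverage region in the form with strict inequalities `R k < (ergodic rate)`. -/
def omaStrictCoverageRegion {Ω : Type*} [MeasurableSpace Ω] (μ : Measure Ω) (W : User → Ω → ℝ)
    (ρ α d : ℝ) (p β δ R : User → ℝ) : Set (User → ℝ) :=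
  {D | ∀ k, 0 < D k ∧ R k < omaErgodicRate μ (W k) ρ α d (p k) (β k) (δ k) (D k)}

/-- `G^{1,3}_{3,2}(x | 1 - κ, 1, 1; 1, 0)` for real `κ` and `x`, a complex number. -/
def coverageG (κ x : ℝ) : ℂ := meijerG 1 3 ![1 - (κ : ℂ), 1, 1] ![1, 0] (x : ℂ)

/-- The closed form
`δ / (Γ(κ) ln 2) * G^{1,3}_{3,2}(τ ρ p β² / (δ d^α D^α) | 1 - κ, 1, 1; 1, 0)`. -/
def omaClosedForm (N : ℕ) (ρ α d p β δ D : ℝ) : ℂ :=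
  ((δ / (Real.Gamma (gammaShape N) * Real.log 2) : ℝ) : ℂ) *
    coverageG (gammaShape N) (gammaScale * ρ * p * β ^ 2 / (δ * d ^ α * D ^ α))

end

/-! Since `Γ(s)² / Γ(1 + s) = Γ(s) / s`, the Mellin–Barnes integrand is `Γ(1 - s) Γ(s) / s · Γ(κ +
s) x ^ s`. The first factor is the Mellin transform of `log (1 + t)` at `-s` (`mellin_log_one_add`:
integrate by parts, then use Euler's beta integral). Writing `Γ(κ + s)` as an integral in `u`,
swapping integrals and applying Mellin inversion at `x u` turns the Meijer function into `∫ log (1 +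
x u) u ^ (κ - 1) e ^ (-u) du` (`mellinBarnes_log_one_add_mul`). With `w = τ u` and `x = τ A` this is
`Γ(κ) E[log (1 + A W)]` (`integral_log_one_add_mul_gammaMeasure`). The coverage regions follow by
substituting this rate. -/

/-! ### The Mellin transform of `log (1 + t)` and its inversion. -/

open Set Filter Topology Asymptotics in
/-- The Mellin transform of `1 / (1 + t)`, Euler's beta integral on the half-line. -/
theorem integral_cpow_neg_mul_inv_one_add {s : ℂ} (hs₀ : 0 < s.re) (hs₁ : s.re < 1) :
    ∫ t : ℝ in Ioi 0, (t : ℂ) ^ (-s) * ((1 + t : ℝ) : ℂ)⁻¹ =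
      Complex.Gamma (1 - s) * Complex.Gamma s := by
  have h1s : 0 < (1 - s).re := by simpa using hs₁
  -- Write `1 / (1 + t)` as `∫ e ^ (-(1 + t) v) dv`; integrating in `t` first then leaves two Gamma
  -- integrals.
  have inner_v : ∀ t ∈ Ioi (0 : ℝ),
      ∫ v : ℝ in Ioi 0, (t : ℂ) ^ (-s) * Complex.exp (-(t * v)) * Complex.exp (-v) =
        (t : ℂ) ^ (-s) * ((1 + t : ℝ) : ℂ)⁻¹ := by
    intro t ht
    have ht : 0 < t := ht
    have h := Complex.integral_cpow_mul_exp_neg_mul_Ioi (a := 1) (r := 1 + t) (by simp)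
      (by positivity)
    simp only [sub_self, Complex.cpow_zero, one_mul, Complex.cpow_one, Complex.Gamma_one, mul_one,
      one_div] at h
    rw [← h, ← integral_const_mul]
    refine setIntegral_congr_fun measurableSet_Ioi fun v _ => ?_
    simp only [mul_assoc, ← Complex.exp_add]
    push_cast
    ring_nf
  have inner_t : ∀ v ∈ Ioi (0 : ℝ),
      ∫ t : ℝ in Ioi 0, (t : ℂ) ^ (-s) * Complex.exp (-(t * v)) * Complex.exp (-v) =
        Complex.Gamma (1 - s) * (Complex.exp (-v) * (v : ℂ) ^ (s - 1)) := by
    intro v hv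
    have hv : 0 < v := hv
    have h := Complex.integral_cpow_mul_exp_neg_mul_Ioi (a := 1 - s) (r := v) h1s hv
    have e : (1 / (v : ℂ)) ^ (1 - s) = (v : ℂ) ^ (s - 1) := by
      rw [one_div, Complex.inv_cpow _ _ (by simp [Complex.arg_ofReal_of_nonneg hv.le, Real.pi_ne_zero.symm]),
        ← Complex.cpow_neg, neg_sub]
    rw [integral_mul_const]
    rw [e, show (1 - s - 1) = -s by ring] at h
    simp_rw [mul_comm (v : ℂ)] at h
    rw [h]
    ring
  rw [← setIntegral_congr_fun measurableSet_Ioi inner_v, integral_integral_swap,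
    setIntegral_congr_fun measurableSet_Ioi inner_t, integral_const_mul,
    Complex.Gamma_eq_integral hs₀, Complex.GammaIntegral]
  · simp
  have hmeas : Measurable (Function.uncurry fun (t v : ℝ) =>
      (t : ℂ) ^ (-s) * Complex.exp (-(t * v)) * Complex.exp (-v)) := by
    unfold Function.uncurry
    fun_prop
  have hnorm : ∀ t ∈ Ioi (0 : ℝ), ∀ v : ℝ,
      ‖(t : ℂ) ^ (-s) * Complex.exp (-(t * v)) * Complex.exp (-v)‖ =
        t ^ (1 - s.re - 1) * Real.exp (-(v * t)) * Real.exp (-v) := by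
    intro t ht v
    have ht : 0 < t := ht
    rw [norm_mul, norm_mul, Complex.norm_cpow_eq_rpow_re_of_pos ht, Complex.norm_exp,
      Complex.norm_exp]
    simp [mul_comm]
  have hre : 0 < 1 - s.re := by linarith
  have hint : ∀ v ∈ Ioi (0 : ℝ),
      IntegrableOn (fun t : ℝ => t ^ (1 - s.re - 1) * Real.exp (-(v * t))) (Ioi 0) := by
    intro v hv
    -- A non-integrable function has Bochner integral `0`, but the closed formula is positive.
    by_contra h
    have h2 := Real.integral_rpow_mul_exp_neg_mul_Ioi hre hv
    rw [integral_undef h] at h2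
    have := Real.Gamma_pos_of_pos hre
    have hv : 0 < v := hv
    have : 0 < (1 / v) ^ (1 - s.re) * Real.Gamma (1 - s.re) := by positivity
    exact this.ne h2
  rw [integrable_prod_iff' hmeas.aestronglyMeasurable]
  constructor
  · filter_upwards [ae_restrict_mem measurableSet_Ioi] with v hv
    refine (integrable_norm_iff ?_).1 ?_
    · unfold Function.uncurry; fun_prop
    · refine (integrableOn_congr_fun (fun t ht => hnorm t ht v) measurableSet_Ioi).2 ?_
      exact (hint v hv).mul_const _
  · have h := (Real.GammaIntegral_convergent hs₀).const_mul (Real.Gamma (1 - s.re))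
    refine h.congr ?_
    filter_upwards [ae_restrict_mem measurableSet_Ioi] with v hv
    refine Eq.trans ?_ (setIntegral_congr_fun measurableSet_Ioi
      fun t ht => hnorm t ht v).symm
    have hv : 0 < v := hv
    rw [integral_mul_const, Real.integral_rpow_mul_exp_neg_mul_Ioi hre hv, one_div,
      Real.inv_rpow hv.le, ← Real.rpow_neg hv.le, neg_sub]
    ring

/-- Subadditivity of `t ^ ε`, then `log (1 + y) ≤ y`. Taking `ε = 1` controls `t → 0`, and small `ε`
controls `t → ∞`. -/
theorem Real.log_one_add_le_rpow_div {t ε : ℝ} (ht : 0 ≤ t) (hε₀ : 0 < ε) (hε₁ : ε ≤ 1) :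
    Real.log (1 + t) ≤ t ^ ε / ε := by
  have h : (1 + t) ^ ε ≤ 1 + t ^ ε := by
    simpa using Real.rpow_add_le_add_rpow zero_le_one ht hε₀.le hε₁
  have h2 : ε * Real.log (1 + t) ≤ t ^ ε := by
    rw [← Real.log_rpow (by positivity)]
    refine (Real.log_le_log (by positivity) h).trans ?_
    linarith [Real.log_le_sub_one_of_pos (show 0 < 1 + t ^ ε by positivity)]
  rw [le_div_iff₀ hε₀]
  linarith

theorem Real.one_add_sq_div_two_le_cosh (x : ℝ) : 1 + x ^ 2 / 2 ≤ Real.cosh x := by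
  have h : (x / 2) ^ 2 ≤ Real.sinh (x / 2) ^ 2 := by
    rw [sq_le_sq, Real.abs_sinh]
    exact Real.self_le_sinh_iff.2 (abs_nonneg _)
  have h2 := Real.cosh_two_mul (x / 2)
  rw [Real.cosh_sq, mul_div_cancel₀ x two_ne_zero] at h2
  linarith

theorem Complex.sin_pi_mul_mul_cosh_le_norm {c t : ℝ} :
    Real.sin (Real.pi * c) * Real.cosh (Real.pi * t) ≤
      ‖Complex.sin (Real.pi * (c + t * Complex.I))‖ := by
  refine le_trans (le_of_eq ?_) (Complex.re_le_norm _)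
  rw [mul_add, ← mul_assoc, ← Complex.ofReal_mul, ← Complex.ofReal_mul, Complex.sin_add_mul_I,
    ← Complex.ofReal_sin, ← Complex.ofReal_cosh, ← Complex.ofReal_cos, ← Complex.ofReal_sinh]
  simp [-Complex.ofReal_sin, -Complex.ofReal_cosh, -Complex.ofReal_cos, -Complex.ofReal_sinh, -Complex.ofReal_mul]

/-- The reflection formula gives `π / sin (π s)`, which decays exponentially along the line; a
quadratic bound suffices for integrability. -/
theorem norm_Gamma_mul_Gamma_div_le {c : ℝ} (hc₀ : 0 < c) (hc₁ : c < 1) (t : ℝ) :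
    ‖Complex.Gamma (1 - (c + t * Complex.I)) * Complex.Gamma (c + t * Complex.I) /
      (c + t * Complex.I)‖ ≤ Real.pi / (Real.sin (Real.pi * c) * c) * (1 + t ^ 2)⁻¹ := by
  have hs : 0 < Real.sin (Real.pi * c) :=
    Real.sin_pos_of_pos_of_lt_pi (by positivity) (by nlinarith [Real.pi_pos])
  have h1 : 1 + t ^ 2 ≤ Real.cosh (Real.pi * t) := by
    refine le_trans ?_ (Real.one_add_sq_div_two_le_cosh (Real.pi * t))
    nlinarith [Real.pi_gt_three, mul_nonneg (sq_nonneg t) (show 0 ≤ Real.pi ^ 2 - 2 by nlinarith [Real.pi_gt_three])]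
  have h2 : c ≤ ‖(c + t * Complex.I : ℂ)‖ := by
    simpa using Complex.re_le_norm (c + t * Complex.I : ℂ)
  rw [mul_comm (Complex.Gamma _), Complex.Gamma_mul_Gamma_one_sub, norm_div, norm_div,
    Complex.norm_real, Real.norm_of_nonneg Real.pi_pos.le, div_div, ← div_eq_mul_inv, div_div]
  have h3 := mul_le_mul_of_nonneg_left h1 hs.le
  have h4 := Complex.sin_pi_mul_mul_cosh_le_norm (c := c) (t := t)
  exact div_le_div_of_nonneg_left Real.pi_pos.le (by positivity)
    (calc _ = Real.sin (Real.pi * c) * (1 + t ^ 2) * c := by ring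
      _ ≤ _ := mul_le_mul (h3.trans h4) h2 hc₀.le (norm_nonneg _))

theorem integrable_Gamma_mul_Gamma_div {c : ℝ} (hc₀ : 0 < c) (hc₁ : c < 1) :
    Integrable fun t : ℝ => Complex.Gamma (1 - (c + t * Complex.I)) *
      Complex.Gamma (c + t * Complex.I) / (c + t * Complex.I) := by
  refine (integrable_inv_one_add_sq.const_mul _).mono' ?_
    (ae_of_all _ (norm_Gamma_mul_Gamma_div_le hc₀ hc₁))
  simp_rw [mul_comm (Complex.Gamma (1 - _)), Complex.Gamma_mul_Gamma_one_sub]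
  exact Measurable.aestronglyMeasurable (by fun_prop)

open Set Filter Topology Asymptotics in
theorem mellinConvergent_log_one_add {s : ℂ} (hs₀ : 0 < s.re) (hs₁ : s.re < 1) :
    MellinConvergent (fun t : ℝ => (Real.log (1 + t) : ℂ)) (-s) := by
  have hbd : ∀ ε : ℝ, 0 < ε → ε ≤ 1 → ∀ t : ℝ, 0 < t →
      ‖(Real.log (1 + t) : ℂ)‖ ≤ ε⁻¹ * ‖t ^ (- -ε)‖ := by
    intro ε hε hε' t ht
    rw [Complex.norm_real, Real.norm_of_nonneg (Real.log_nonneg (by linarith)), neg_neg,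
      Real.norm_of_nonneg (by positivity), inv_mul_eq_div]
    exact Real.log_one_add_le_rpow_div ht.le hε hε'
  refine mellinConvergent_of_isBigO_rpow (a := -(s.re / 2)) (b := -1) ?_ ?_ ?_ ?_ ?_
  · refine ContinuousOn.locallyIntegrableOn ?_ measurableSet_Ioi
    refine Complex.continuous_ofReal.comp_continuousOn (ContinuousOn.log (by fun_prop) ?_)
    intro t (ht : 0 < t)
    positivity
  · refine IsBigO.of_bound (s.re / 2)⁻¹ ?_
    filter_upwards [eventually_gt_atTop 0] with t ht
    exact hbd _ (by linarith) (by linarith) t ht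
  · simp; linarith
  · refine IsBigO.of_bound 1⁻¹ ?_
    filter_upwards [self_mem_nhdsWithin] with t ht
    exact hbd _ one_pos le_rfl t ht
  · simpa using hs₁

open Set Filter Topology Asymptotics in
/-- The Mellin transform of `log (1 + t)`. -/
theorem mellin_log_one_add {s : ℂ} (hs₀ : 0 < s.re) (hs₁ : s.re < 1) :
    mellin (fun t : ℝ => (Real.log (1 + t) : ℂ)) (-s) =
      Complex.Gamma (1 - s) * Complex.Gamma s / s := by
  have hs : s ≠ 0 := fun h => by simp [h] at hs₀
  have hnorm : ∀ t : ℝ, 0 < t →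
      ‖(Real.log (1 + t) : ℂ) * ((t : ℂ) ^ (-s) / (-s))‖ =
        Real.log (1 + t) * t ^ (-s.re) / ‖s‖ := by
    intro t ht
    rw [norm_mul, norm_div, Complex.norm_cpow_eq_rpow_re_of_pos ht, Complex.norm_real,
      Real.norm_of_nonneg (Real.log_nonneg (by linarith)), norm_neg, Complex.neg_re, mul_div_assoc]
  have hle : ∀ ε : ℝ, 0 < ε → ε ≤ 1 → ∀ t : ℝ, 0 < t →
      ‖(Real.log (1 + t) : ℂ) * ((t : ℂ) ^ (-s) / (-s))‖ ≤ t ^ (ε - s.re) / (ε * ‖s‖) := by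
    intro ε hε hε' t ht
    rw [hnorm t ht, sub_eq_add_neg, Real.rpow_add ht]
    calc _ ≤ t ^ ε / ε * t ^ (-s.re) / ‖s‖ := by
          gcongr
          exact Real.log_one_add_le_rpow_div ht.le hε hε'
      _ = _ := by ring
  have hconv : IntegrableOn (fun t : ℝ => ((1 + t : ℝ) : ℂ)⁻¹ * ((t : ℂ) ^ (-s) / (-s)))
      (Ioi 0) := by
    have h : MellinConvergent (fun t : ℝ => ((1 + t : ℝ) : ℂ)⁻¹) (1 - s) := by
      refine mellinConvergent_of_isBigO_rpow (a := 1) (b := 0) ?_ ?_ ?_ ?_ ?_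
      · refine ContinuousOn.locallyIntegrableOn (ContinuousOn.inv₀ (by fun_prop) ?_)
          measurableSet_Ioi
        intro t (ht : 0 < t)
        exact_mod_cast (show (1 + t : ℝ) ≠ 0 by positivity)
      · refine IsBigO.of_bound 1 ?_
        filter_upwards [eventually_gt_atTop 0] with t ht
        rw [norm_inv, Complex.norm_real, Real.norm_of_nonneg (by positivity), Real.rpow_neg_one,
          Real.norm_of_nonneg (by positivity), one_mul]
        gcongr
        linarith
      · simpa using hs₀
      · refine IsBigO.of_bound 1 ?_
        filter_upwards [self_mem_nhdsWithin] with t (ht : 0 < t)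
        rw [norm_inv, Complex.norm_real, Real.norm_of_nonneg (by positivity)]
        simpa using inv_le_one_of_one_le₀ (by linarith)
      · simpa using hs₁
    refine (h.mul_const (-s)⁻¹).congr (ae_of_all _ fun t => ?_)
    simp only [smul_eq_mul, show 1 - s - 1 = -s by ring]
    ring
  -- Boundary terms vanish: `log (1 + t)` is `O(t)` at `0` and `O(t ^ (Re s / 2))` at infinity, with
  -- `0 < Re s < 1`.
  have key := integral_Ioi_mul_deriv_eq_deriv_mul (a := (0 : ℝ)) (a' := (0 : ℂ)) (b' := 0)
    (u := fun t : ℝ => (Real.log (1 + t) : ℂ)) (u' := fun t : ℝ => ((1 + t : ℝ) : ℂ)⁻¹)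
    (v := fun t : ℝ => (t : ℂ) ^ (-s) / (-s)) (v' := fun t : ℝ => (t : ℂ) ^ (-s - 1))
    ?_ ?_ ?_ hconv ?_ ?_
  · rw [mellin]
    simp only [smul_eq_mul]
    simp_rw [mul_comm ((_ : ℂ) ^ (-s - 1))]
    rw [key, ← integral_cpow_neg_mul_inv_one_add hs₀ hs₁, sub_zero, zero_sub, ← integral_neg,
      ← integral_div]
    refine integral_congr_ae (ae_of_all _ fun t => ?_)
    simp only
    field_simp
  · intro t (ht : 0 < t)
    have h : HasDerivAt (fun t : ℝ => Real.log (1 + t)) (1 + t)⁻¹ t := by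
      simpa using ((hasDerivAt_id t).const_add 1).log (by simp; positivity)
    exact_mod_cast h.ofReal_comp
  · intro t (ht : 0 < t)
    simpa using hasDerivAt_ofReal_cpow_const' ht.ne' (r := -s - 1) (by simpa using hs)
  · refine (mellinConvergent_log_one_add hs₀ hs₁).congr (ae_of_all _ fun t => ?_)
    simp [mul_comm]
  · refine squeeze_zero_norm' (a := fun t : ℝ => t ^ (1 - s.re) / (1 * ‖s‖)) ?_ ?_
    · filter_upwards [self_mem_nhdsWithin] with t ht
      exact hle 1 one_pos le_rfl t ht
    · have h : ContinuousAt (fun t : ℝ => t ^ (1 - s.re) / (1 * ‖s‖)) 0 :=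
        (Real.continuousAt_rpow_const _ _ (Or.inr (by linarith))).div_const _
      have h2 := h.tendsto
      rw [Real.zero_rpow (by linarith), zero_div] at h2
      exact h2.mono_left nhdsWithin_le_nhds
  · refine squeeze_zero_norm' (a := fun t : ℝ => t ^ (-(s.re / 2)) / (s.re / 2 * ‖s‖)) ?_ ?_
    · filter_upwards [eventually_gt_atTop 0] with t ht
      have := hle (s.re / 2) (by linarith) (by linarith) t ht
      rwa [show s.re / 2 - s.re = -(s.re / 2) by ring] at this
    · simpa using (tendsto_rpow_neg_atTop (half_pos hs₀)).div_const (s.re / 2 * ‖s‖)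

/-- Mellin inversion for `log (1 + t)`. -/
theorem integral_Gamma_mul_Gamma_div_mul_cpow {c x : ℝ} (hc₀ : 0 < c) (hc₁ : c < 1) (hx : 0 < x) :
    ∫ t : ℝ, Complex.Gamma (1 - (c + t * Complex.I)) * Complex.Gamma (c + t * Complex.I) /
      (c + t * Complex.I) * (x : ℂ) ^ (c + t * Complex.I) =
        2 * Real.pi * (Real.log (1 + x) : ℂ) := by
  -- Inversion runs along `Re = -c`, so the height `t` changes sign; `integral_neg_eq_self` undoes
  -- this.
  have hm : ∀ t : ℝ, mellin (fun t : ℝ => (Real.log (1 + t) : ℂ)) ((-c : ℝ) + t * Complex.I) =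
      Complex.Gamma (1 - (c + (-t : ℝ) * Complex.I)) * Complex.Gamma (c + (-t : ℝ) * Complex.I) /
        (c + (-t : ℝ) * Complex.I) := by
    intro t
    rw [← mellin_log_one_add (by simpa using hc₀) (by simpa using hc₁)]
    congr 1
    push_cast
    ring
  have h := mellinInv_mellin_eq (-c) (fun t : ℝ => (Real.log (1 + t) : ℂ)) hx ?_ ?_ ?_
  · rw [mellinInv] at h
    simp_rw [hm] at h
    rw [← integral_neg_eq_self, ← h, Complex.real_smul]
    push_cast
    rw [← mul_assoc, mul_one_div_cancel (by simp [Real.pi_ne_zero]), one_mul]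
    refine integral_congr_ae (ae_of_all _ fun t => ?_)
    simp only [smul_eq_mul]
    rw [mul_comm]
    congr 2
    ring
  · simpa using mellinConvergent_log_one_add (s := (c : ℂ)) (by simpa using hc₀)
      (by simpa using hc₁)
  · rw [Complex.VerticalIntegrable]
    simp_rw [hm]
    exact (integrable_Gamma_mul_Gamma_div hc₀ hc₁).comp_neg
  · refine Complex.continuous_ofReal.continuousAt.comp (ContinuousAt.log (by fun_prop) ?_)
    positivity

/-! ### The Meijer function as a real integral. -/

open Set in
/-- The Mellin--Barnes representation of `∫ log (1 + x u) u ^ (κ - 1) e ^ (-u) du`. -/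
theorem mellinBarnes_log_one_add_mul {κ c x : ℝ} (hκ : 0 < κ) (hc₀ : 0 < c) (hc₁ : c < 1)
    (hx : 0 < x) :
    Integrable (fun t : ℝ => Complex.Gamma (1 - (c + t * Complex.I)) *
      Complex.Gamma (c + t * Complex.I) / (c + t * Complex.I) *
        Complex.Gamma (κ + (c + t * Complex.I)) * (x : ℂ) ^ (c + t * Complex.I)) ∧
    ∫ t : ℝ, Complex.Gamma (1 - (c + t * Complex.I)) *
      Complex.Gamma (c + t * Complex.I) / (c + t * Complex.I) *
        Complex.Gamma (κ + (c + t * Complex.I)) * (x : ℂ) ^ (c + t * Complex.I) =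
      2 * Real.pi *
        ((∫ u in Ioi 0, Real.log (1 + x * u) * (u ^ (κ - 1) * Real.exp (-u)) : ℝ) : ℂ) := by
  set B : ℝ → ℂ := fun t => Complex.Gamma (1 - (c + t * Complex.I)) *
    Complex.Gamma (c + t * Complex.I) / (c + t * Complex.I) with hB
  have hBi : Integrable B := integrable_Gamma_mul_Gamma_div hc₀ hc₁
  set h : ℝ → ℝ → ℂ := fun t u => B t * (x : ℂ) ^ (c + t * Complex.I) *
    (Complex.exp (-u) * (u : ℂ) ^ (κ + (c + t * Complex.I) - 1)) with hh
  have hpos : 0 < κ + c := by positivity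
  have hint : Integrable (Function.uncurry h) (volume.prod (volume.restrict (Ioi 0))) := by
    have hdom := (hBi.norm.mul_const (x ^ c)).mul_prod (Real.GammaIntegral_convergent hpos)
    refine hdom.mono' ?_ ?_
    · have hm : AEStronglyMeasurable (fun z : ℝ × ℝ => B z.1)
          (volume.prod (volume.restrict (Ioi 0))) := hBi.aestronglyMeasurable.comp_fst
      refine (hm.mul (Measurable.aestronglyMeasurable (by fun_prop))).mul
        (Measurable.aestronglyMeasurable (by fun_prop))
    · have hae : ∀ᵐ z : ℝ × ℝ ∂(volume.prod (volume.restrict (Ioi 0))), z.2 ∈ Ioi (0 : ℝ) :=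
        Measure.quasiMeasurePreserving_snd.ae (ae_restrict_mem measurableSet_Ioi)
      filter_upwards [hae] with z (hz : 0 < z.2)
      simp only [Function.uncurry, hh, norm_mul, Complex.norm_cpow_eq_rpow_re_of_pos hx,
        Complex.norm_cpow_eq_rpow_re_of_pos hz, Complex.norm_exp]
      simp
  have inner_u : ∀ t : ℝ, ∫ u in Ioi 0, h t u =
      B t * Complex.Gamma (κ + (c + t * Complex.I)) * (x : ℂ) ^ (c + t * Complex.I) := by
    intro t
    simp only [hh]
    rw [integral_const_mul, Complex.Gamma_eq_integral (by simpa using hpos),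
      Complex.GammaIntegral]
    push_cast
    ring
  have inner_t : ∀ u ∈ Ioi (0 : ℝ), ∫ t : ℝ, h t u =
      2 * Real.pi * ((Real.log (1 + x * u) * (u ^ (κ - 1) * Real.exp (-u)) : ℝ) : ℂ) := by
    intro u (hu : 0 < u)
    -- Merging `x ^ s u ^ s = (x u) ^ s` makes this Mellin inversion at the point `x u`.
    have e : ∀ t : ℝ, h t u = B t * ((x * u : ℝ) : ℂ) ^ (c + t * Complex.I) *
        ((u ^ (κ - 1) * Real.exp (-u) : ℝ) : ℂ) := by
      intro t
      simp only [hh]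
      rw [show (κ + (c + t * Complex.I) - 1 : ℂ) = (c + t * Complex.I) + ((κ - 1 : ℝ) : ℂ) by
          push_cast; ring, Complex.cpow_add (x := (u : ℂ)) _ _ (by exact_mod_cast hu.ne'), Complex.ofReal_mul x,
        Complex.mul_cpow_ofReal_nonneg hx.le hu.le, Complex.ofReal_mul, Complex.ofReal_cpow hu.le]
      push_cast
      ring
    simp_rw [e]
    rw [integral_mul_const, integral_Gamma_mul_Gamma_div_mul_cpow hc₀ hc₁ (by positivity)]
    push_cast
    ring
  constructor
  · exact (hint.integral_prod_left).congr (ae_of_all _ inner_u)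
  · rw [← integral_congr_ae (ae_of_all _ inner_u), integral_integral_swap hint,
      setIntegral_congr_fun measurableSet_Ioi inner_t, integral_const_mul, integral_complex_ofReal]

-- The poles nearest the strip are `0`, from `Γ(s)`, and `1`, from `Γ(1 - s)`, so the separating
-- lines are exactly those with `0 < c < 1`; those of `Γ(κ + s)` lie further left as `κ > 0`.
open Set in
theorem hasMeijerG_log_one_add_mul {κ x : ℝ} (hκ : 0 < κ) (hx : 0 < x) :
    HasMeijerG 1 3 ![1 - (κ : ℂ), 1, 1] ![1, 0] (x : ℂ)
      ((∫ u in Ioi 0, Real.log (1 + x * u) * (u ^ (κ - 1) * Real.exp (-u)) : ℝ) : ℂ) := by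
  have hsep : ∀ c : ℝ, MeijerGSeparates 1 3 ![1 - (κ : ℂ), 1, 1] ![1, 0] c ↔ 0 < c ∧ c < 1 := by
    intro c
    constructor
    · rintro ⟨h1, h2⟩
      exact ⟨by simpa using h2 1 (by simp) 0, by simpa using h1 0 (by simp) 0⟩
    · rintro ⟨h1, h2⟩
      refine ⟨fun j hj l => ?_, fun j _ l => ?_⟩
      · fin_cases j
        · simp
          linarith [Nat.cast_nonneg (α := ℝ) l]
        · simp at hj
      · fin_cases j <;> simp <;> linarith [Nat.cast_nonneg (α := ℝ) l]
  refine ⟨⟨1 / 2, (hsep _).2 (by norm_num)⟩, fun c hc => ?_⟩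
  obtain ⟨hc₀, hc₁⟩ := (hsep c).1 hc
  obtain ⟨hi, he⟩ := mellinBarnes_log_one_add_mul hκ hc₀ hc₁ hx
  have hG : ∀ t : ℝ, meijerGIntegrand 1 3 ![1 - (κ : ℂ), 1, 1] ![1, 0] (x : ℂ)
      (c + t * Complex.I) = Complex.Gamma (1 - (c + t * Complex.I)) *
      Complex.Gamma (c + t * Complex.I) / (c + t * Complex.I) *
        Complex.Gamma (κ + (c + t * Complex.I)) * (x : ℂ) ^ (c + t * Complex.I) := by
    intro t
    have hre : 0 < (c + t * Complex.I : ℂ).re := by simpa using hc₀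
    set s : ℂ := c + t * Complex.I
    have hs : s ≠ 0 := fun h => by simp [h] at hre
    have hΓ := Complex.Gamma_ne_zero_of_re_pos hre
    simp only [meijerGIntegrand, Fin.prod_univ_succ]
    simp
    rw [add_comm 1 s, Complex.Gamma_add_one s hs]
    field_simp
    simp
  simp only [Complex.VerticalIntegrable, hG]
  refine ⟨hi, ?_⟩
  rw [integral_mul_const, he]
  field_simp [Real.pi_ne_zero]

/-- Any one separating line determines the value, so the chosen witness must be `w`. -/
theorem HasMeijerG.meijerG_eq {m n p q : ℕ} {a : Fin p → ℂ} {b : Fin q → ℂ} {z w : ℂ}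
    (h : HasMeijerG m n a b z w) : meijerG m n a b z = w := by
  have hex : ∃ w, HasMeijerG m n a b z w := ⟨w, h⟩
  rw [meijerG, dif_pos hex]
  obtain ⟨c, hc⟩ := h.1
  rw [← (h.2 c hc).2, ← (hex.choose_spec.2 c hc).2]

theorem coverageG_eq {κ x : ℝ} (hκ : 0 < κ) (hx : 0 < x) :
    coverageG κ x =
      ((∫ u in Set.Ioi 0, Real.log (1 + x * u) * (u ^ (κ - 1) * Real.exp (-u)) : ℝ) : ℂ) :=
  (hasMeijerG_log_one_add_mul hκ hx).meijerG_eq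

/-! ### Expectation under the Gamma law. -/

open Set in
theorem integrableOn_log_one_add_mul_rpow_mul_exp {κ A τ : ℝ} (hκ : 0 < κ) (hA : 0 < A)
    (hτ : 0 < τ) :
    IntegrableOn (fun w => Real.log (1 + A * w) * (w ^ (κ - 1) * Real.exp (-(1 / τ * w))))
      (Ioi 0) := by
  have h := (integrableOn_rpow_mul_exp_neg_mul_rpow (p := 1) (s := κ) (b := 1 / τ) (by linarith)
    one_pos (by positivity)).const_mul A
  refine h.mono' (Measurable.aestronglyMeasurable (by fun_prop)) ?_
  filter_upwards [ae_restrict_mem measurableSet_Ioi] with w (hw : 0 < w)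
  have hAw : 0 < A * w := by positivity
  rw [norm_mul, Real.norm_of_nonneg (Real.log_nonneg (by linarith)),
    Real.norm_of_nonneg (by positivity)]
  calc _ ≤ A * w * (w ^ (κ - 1) * Real.exp (-(1 / τ * w))) := by
        gcongr
        linarith [Real.log_le_sub_one_of_pos (show 0 < 1 + A * w by positivity)]
    _ = _ := by
        rw [Real.rpow_sub_one hw.ne', Real.rpow_one, neg_mul]
        field_simp

open Set in
/-- The expectation of `log (1 + A W)` for a Gamma distributed `W`. -/
theorem integral_log_one_add_mul_gammaMeasure {κ A τ : ℝ} (hκ : 0 < κ) (hA : 0 < A) (hτ : 0 < τ) :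
    Integrable (fun w => Real.log (1 + A * w)) (gammaMeasure κ (1 / τ)) ∧
    ∫ w, Real.log (1 + A * w) ∂gammaMeasure κ (1 / τ) =
      (Real.Gamma κ)⁻¹ *
        ∫ u in Ioi 0, Real.log (1 + τ * A * u) * (u ^ (κ - 1) * Real.exp (-u)) := by
  have hr : 0 < 1 / τ := by positivity
  have hm : Measurable (gammaPDF κ (1 / τ)) := (measurable_gammaPDFReal _ _).ennreal_ofReal
  have hlt : ∀ᵐ w, gammaPDF κ (1 / τ) w < ⊤ := ae_of_all _ fun _ => ENNReal.ofReal_lt_top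
  have hind : (fun w => (gammaPDF κ (1 / τ) w).toReal • Real.log (1 + A * w)) =ᵐ[volume]
      (Ioi 0).indicator fun w => ((1 / τ) ^ κ / Real.Gamma κ) *
        (Real.log (1 + A * w) * (w ^ (κ - 1) * Real.exp (-(1 / τ * w)))) := by
    -- `gammaPDFReal` uses the branch `0 ≤ w`, while the indicator is of the open half-line; they
    -- can differ only at `0`.
    have h0 : ∀ᵐ w : ℝ, w ≠ 0 := by simp [ae_iff]
    filter_upwards [h0] with w hw
    rw [gammaPDF, ENNReal.toReal_ofReal (gammaPDFReal_nonneg hκ hr w), gammaPDFReal]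
    rcases lt_or_gt_of_ne hw with h | h
    · rw [if_neg h.not_ge, indicator_of_notMem (by simpa using h.le), zero_smul]
    · rw [if_pos h.le, indicator_of_mem (by simpa using h), smul_eq_mul]
      ring
  have hi := integrableOn_log_one_add_mul_rpow_mul_exp hκ hA hτ
  constructor
  · rw [gammaMeasure, integrable_withDensity_iff_integrable_smul' hm hlt, integrable_congr hind,
      integrable_indicator_iff measurableSet_Ioi]
    exact hi.const_mul _
  · rw [gammaMeasure, integral_withDensity_eq_integral_toReal_smul hm hlt, integral_congr_ae hind,
      integral_indicator measurableSet_Ioi, integral_const_mul]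
    have hsub := integral_comp_mul_left_Ioi'
      (fun w => Real.log (1 + A * w) * (w ^ (κ - 1) * Real.exp (-(1 / τ * w)))) 0 hτ
    rw [mul_zero] at hsub
    rw [← hsub, smul_eq_mul, ← integral_const_mul, ← integral_const_mul, ← integral_const_mul]
    refine setIntegral_congr_fun measurableSet_Ioi fun u (hu : 0 < u) => ?_
    have e1 : 1 / τ * (τ * u) = u := by field_simp
    -- The normalising constant, the Jacobian and the power of `w = τ u` cancel.
    have e2 : (1 / τ) ^ κ * τ * τ ^ (κ - 1) = 1 := by
      rw [one_div, Real.inv_rpow hτ.le, Real.rpow_sub_one hτ.ne']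
      have := Real.rpow_pos_of_pos hτ κ
      field_simp
    rw [e1, Real.mul_rpow hτ.le hu.le, show A * (τ * u) = τ * A * u by ring]
    linear_combination (Real.Gamma κ)⁻¹ * Real.log (1 + τ * A * u) * u ^ (κ - 1) *
      Real.exp (-u) * e2

/-! ### Ergodic rates and coverage regions. -/

theorem gammaScale_pos : 0 < gammaScale := by
  have := Real.pi_pos
  have := Real.pi_lt_four
  exact div_pos (by nlinarith) (by positivity)

theorem gammaShape_pos {N : ℕ} (hN : 1 ≤ N) : 0 < gammaShape N := by
  have := Real.pi_pos
  have := Real.pi_lt_four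
  have : (0 : ℝ) < N := by exact_mod_cast hN
  exact div_pos (by positivity) (by nlinarith)

theorem integrable_logb_omaSNR_and_omaErgodicRate_eq {Ω : Type*} [MeasurableSpace Ω]
    {μ : Measure Ω} {N : ℕ} (hN : 1 ≤ N) {W : Ω → ℝ} (hW : IsGammaChannel μ N W)
    {ρ α d p β δ D : ℝ} (hρ : 0 < ρ) (hd : 0 < d) (hp : 0 < p) (hβ : 0 < β) (hδ : 0 < δ)
    (hD : 0 < D) :
    Integrable (fun ω => Real.logb 2 (1 + omaSNR ρ α d p β δ D (W ω))) μ ∧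
    (omaErgodicRate μ W ρ α d p β δ D : ℂ) = omaClosedForm N ρ α d p β δ D := by
  have hκ := gammaShape_pos hN
  have hτ := gammaScale_pos
  set A : ℝ := ρ * p * β ^ 2 / (δ * d ^ α * D ^ α) with hA
  have hA₀ : 0 < A := by positivity
  have hfun : (fun ω => Real.logb 2 (1 + omaSNR ρ α d p β δ D (W ω))) =
      fun ω => (Real.log 2)⁻¹ * Real.log (1 + A * W ω) := by
    funext ω
    rw [Real.logb, omaSNR, hA, div_eq_inv_mul, div_mul_eq_mul_div]
  obtain ⟨hi, he⟩ := integral_log_one_add_mul_gammaMeasure hκ hA₀ hτ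
  have hx : gammaScale * ρ * p * β ^ 2 / (δ * d ^ α * D ^ α) = gammaScale * A := by
    rw [hA]; ring
  have hW' : HasLaw W (gammaMeasure (gammaShape N) (1 / gammaScale)) μ := hW
  constructor
  · rw [hfun]
    refine Integrable.const_mul ?_ _
    rw [← hW'.map_eq] at hi
    exact hi.comp_aemeasurable hW'.aemeasurable
  · have hcomp := hW'.integral_comp hi.aestronglyMeasurable
    rw [omaErgodicRate, hfun, integral_const_mul, omaClosedForm, hx,
      coverageG_eq hκ (by positivity), ← Complex.ofReal_mul]
    simp only [Function.comp_def] at hcomp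
    rw [hcomp, he]
    congr 1
    rw [div_eq_mul_inv, mul_inv]
    ring

theorem theorem2 {Ω : Type*} [MeasurableSpace Ω] (μ : Measure Ω) [IsProbabilityMeasure μ]
    (N : ℕ) (hN : 1 ≤ N)
    (W : User → Ω → ℝ) (hW : ∀ k, IsGammaChannel μ N (W k))
    (ρ α d : ℝ) (hρ : 0 < ρ) (hd : 0 < d)
    (p β δ R : User → ℝ) (hp : ∀ k, 0 < p k) (hβ : ∀ k, 0 < β k)
    (hδ : ∀ k, 0 < δ k ∧ δ k ≤ 1) :
    -- for each user and each distance, the ergodic rate is finite, the Meijer function is given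
    -- by a convergent integral, and the rate is the closed form (in particular a real number)
    (∀ (k : User) (D : ℝ), 0 < D →
      Integrable (fun ω => Real.logb 2 (1 + omaSNR ρ α d (p k) (β k) (δ k) D (W k ω))) μ ∧
      HasMeijerG 1 3 ![1 - (gammaShape N : ℂ), 1, 1] ![1, 0]
        ((gammaScale * ρ * p k * β k ^ 2 / (δ k * d ^ α * D ^ α) : ℝ) : ℂ)
        (coverageG (gammaShape N)
          (gammaScale * ρ * p k * β k ^ 2 / (δ k * d ^ α * D ^ α))) ∧
      (omaErgodicRate μ (W k) ρ α d (p k) (β k) (δ k) D : ℂ) =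
        omaClosedForm N ρ α d (p k) (β k) (δ k) D ∧
      (R k ≤ omaErgodicRate μ (W k) ρ α d (p k) (β k) (δ k) D ↔
        R k ≤ (omaClosedForm N ρ α d (p k) (β k) (δ k) D).re)) ∧
    -- hence the coverage regions
    omaCoverageRegion μ W ρ α d p β δ R =
      {D | ∀ k, 0 < D k ∧ R k ≤ (omaClosedForm N ρ α d (p k) (β k) (δ k) (D k)).re} ∧
    omaStrictCoverageRegion μ W ρ α d p β δ R =
      {D | ∀ k, 0 < D k ∧ R k < (omaClosedForm N ρ α d (p k) (β k) (δ k) (D k)).re} := by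
  have key : ∀ (k : User) (D : ℝ), 0 < D → _ := fun k D hD =>
    integrable_logb_omaSNR_and_omaErgodicRate_eq (α := α) hN (hW k) hρ hd (hp k) (hβ k) (hδ k).1 hD
  have hre : ∀ (k : User) (D : ℝ), 0 < D →
      (omaClosedForm N ρ α d (p k) (β k) (δ k) D).re =
        omaErgodicRate μ (W k) ρ α d (p k) (β k) (δ k) D := fun k D hD => by
    rw [← (key k D hD).2, Complex.ofReal_re]
  refine ⟨fun k D hD => ⟨(key k D hD).1, ?_, (key k D hD).2, by rw [hre k D hD]⟩, ?_, ?_⟩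
  · have := hp k
    have := hβ k
    have := (hδ k).1
    have := gammaScale_pos
    have hx : 0 < gammaScale * ρ * p k * β k ^ 2 / (δ k * d ^ α * D ^ α) := by positivity
    rw [coverageG_eq (gammaShape_pos hN) hx]
    exact hasMeijerG_log_one_add_mul (gammaShape_pos hN) hx
  · ext D
    exact forall_congr' fun k => and_congr_right fun hD => by rw [hre k _ hD]
  · ext D
    exact forall_congr' fun k => and_congr_right fun hD => by rw [hre k _ hD]
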